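/- **Conventions.** Varieties are complex algebraic varieties (reduced, separated, of finite type, possibly reducible), identified with their sets of points. An *antiregular* (algebraically antiholomorphic) map $\varphi : X\to Y$ is a Zariski-continuous map such that $\overline{h\circ\varphi}$ is regular on $\varphi^{-1}(U)$ for every regular function $h$ on an open set $U\subseteq Y$. Let $G$ be a complex algebraic group. A *real form* of $G$ is an antiregular involution $\sigma$ of $G$ that is a group automorphism. For a $G$-variety $Y$, a *(equivariant) real form of $Y$ compatible with $\sigma$* is an antiregular involution $\mu$ of $Y$ with $\mu(gy)=\sigma(g)\mu(y)$ for all $g\in G$, $y\in Y$. A *$G$-automorphism* of $Y$ is a $G$-equivariant map $Y\to Y$ that is bijective and regular with regular inverse. Two equivariant real forms $\mu,\mu'$ of $Y$ are *equivalent* if $\mu'=\psi\circ\mu\circ\psi^{-1}$ for some $G$-automorphism $\psi$ of $Y$. Let $B$ be a $G$-variety with a real form $\mu_B$ compatible with $\sigma$, let $F$ be a finite-dimensional rational $G$-module, and let $\pi:E=B\times F\to B$ be the trivial $G$-vector bundle, with $g(b,v)=(gb,gv)$. A *$G$-vector bundle real form* of $E$ (compatible with $\sigma$ and $\mu_B$)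 is an equivariant real form $\mu$ of the $G$-variety $E$, compatible with $\sigma$, such that $\pi\circ\mu=\mu_B\circ\pi$ and $\mu$ is $\mathbb R$-linear from the fibre over $b$ to the fibre over $\mu_B(b)$ for each $b\in B$. A *$G$-vector bundle automorphism* of $E$ is a $G$-automorphism $\psi$ of $E$ with $\pi\circ\psi=\pi$ that is $\mathbb C$-linear on each fibre. Two $G$-vector bundle real forms $\mu,\mu'$ are *equivalent as $G$-vector bundle real forms* if $\mu'=\psi\circ\mu\circ\psi^{-1}$ for some $G$-vector bundle automorphism $\psi$ of $E$. For a $G$-automorphism $f$ of $B$ put $f^*\mu=(f\times\mathrm{id}_F)\circ\mu\circ(f\times\mathrm{id}_F)^{-1}$. **Proposition 4.2.** In this situation, suppose that $G$ has a subgroup $H$ whose fixed point set $E^H$ is the zero section $B\times\{0\}$. Let $\mu_1,\mu_2$ be two $G$-vector bundle real forms of $E$ compatible with $\sigma$ and $\mu_B$. Then $\mu_1$ and $\mu_2$ are equivalent as equivariant real forms of the $G$-variety $E$ if and only if there is a $G$-automorphism $f$ of $B$ with $f\circ\mu_B\circ f^{-1}=\mu_B$ such that $\mu_1$ and $f^*\mu_2$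 are equivalent as $G$-vector bundle real forms. -/

import Mathlib

namespace EquivariantRealForms

open scoped Topology

universe u v

/-- A space with functions: a topology on `X` together with a sheaf of `ℂ`-valued functions.
The sheaf is recorded through the relation `RegularAt f x`, "`f` is regular on some open
neighbourhood of `x`"; a function is a section over an open set `U` when it is regular at every
point of `U` (its values outside `U` are irrelevant, by `regularAt_congr`). -/
@[ext]
structure FunctionSpace (X : Type u) where
  /-- the (Zariski) topology -/
  topology : TopologicalSpace X
  /-- regularity of a function in a neighbourhood of a point -/
  RegularAt : (X → ℂ) → X → Prop
  regularAt_congr : ∀ (f g : X → ℂ) (U : Set X) (x : X), IsOpen[topology] U → x ∈ U →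
    (∀ y ∈ U, f y = g y) → RegularAt f x → RegularAt g x
  regularAt_nhds : ∀ (f : X → ℂ) (x : X), RegularAt f x →
    ∃ U : Set X, IsOpen[topology] U ∧ x ∈ U ∧ ∀ y ∈ U, RegularAt f y

namespace FunctionSpace

variable {X : Type u} {Y : Type v}

/-- `f` restricts to a regular function on `U`. -/
def RegularOn (S : FunctionSpace X) (f : X → ℂ) (U : Set X) : Prop :=
  ∀ x ∈ U, S.RegularAt f x

/-- The space with functions attached to a `ℂ`-algebra `A` of functions on `X`: the topology has
the non-vanishing loci of the elements of `A` as a basis, and regular functions are locally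
quotients of elements of `A`. -/
def ofAlgebra (A : Subalgebra ℂ (X → ℂ)) : FunctionSpace X where
  topology := TopologicalSpace.generateFrom {D | ∃ h ∈ A, D = {x | h x ≠ 0}}
  RegularAt f x := ∃ a ∈ A, ∃ h ∈ A, ∃ W : Set X,
    IsOpen[TopologicalSpace.generateFrom {D | ∃ h ∈ A, D = {x | h x ≠ 0}}] W ∧ x ∈ W ∧
      ∀ y ∈ W, h y ≠ 0 ∧ f y = a y / h y
  regularAt_congr := by
    rintro f g U x hU hxU hfg ⟨a, ha, h, hh, W, hW, hxW, H⟩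
    refine ⟨a, ha, h, hh, W ∩ U, ?_, ⟨hxW, hxU⟩, fun y hy => ⟨(H y hy.1).1, ?_⟩⟩
    · exact @IsOpen.inter X (TopologicalSpace.generateFrom _) W U hW hU
    · rw [← hfg y hy.2]
      exact (H y hy.1).2
  regularAt_nhds := by
    rintro f x ⟨a, ha, h, hh, W, hW, hxW, H⟩
    exact ⟨W, hW, hxW, fun y hy => ⟨a, ha, h, hh, W, hW, hy, H⟩⟩

/-- The open subspace with functions on an open set `U`. -/
def restrict (S : FunctionSpace X) (U : Set X) (hU : IsOpen[S.topology] U) : FunctionSpace U where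
  topology := S.topology.induced Subtype.val
  RegularAt f x := ∃ g : X → ℂ, S.RegularAt g x ∧ ∀ y : U, f y = g y
  regularAt_congr := by
    classical
    rintro f g V x ⟨V', hV', rfl⟩ hxV hfg ⟨k, hk, hfk⟩
    refine ⟨fun y => if hy : y ∈ U then g ⟨y, hy⟩ else 0, ?_, fun y => by simp⟩
    refine S.regularAt_congr k _ (V' ∩ U) x ?_ ⟨hxV, x.2⟩ ?_ hk
    · exact @IsOpen.inter X S.topology V' U hV' hU
    · intro y hy
      simp only [hy.2, dite_true]
      rw [← hfg ⟨y, hy.2⟩ hy.1, hfk]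
  regularAt_nhds := by
    rintro f x ⟨g, hg, hfg⟩
    obtain ⟨V, hV, hxV, H⟩ := S.regularAt_nhds g x hg
    exact ⟨Subtype.val ⁻¹' V, ⟨V, hV, rfl⟩, hxV, fun y hy => ⟨g, H y hy, hfg⟩⟩

/-- `S` is an affine variety: it is isomorphic, through coordinate functions `φ`, to a Zariski
closed subset of some `ℂⁿ` with its regular functions. -/
def IsAffine (S : FunctionSpace X) : Prop :=
  ∃ (n : ℕ) (φ : X → Fin n → ℂ), Function.Injective φ ∧
    (∃ P : Set (MvPolynomial (Fin n) ℂ),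
      Set.range φ = {z | ∀ p ∈ P, MvPolynomial.eval z p = 0}) ∧
    S = ofAlgebra (Algebra.adjoin ℂ (Set.range fun (i : Fin n) (x : X) => φ x i))

/-- The finite sums `∑ f_k(x) g_k(y)` with `f_k` regular on `U` and `g_k` regular on `V`. -/
def tensorFunctions (S : FunctionSpace X) (T : FunctionSpace Y) (U : Set X) (V : Set Y) :
    Submodule ℂ (X × Y → ℂ) :=
  Submodule.span ℂ {k | ∃ f g, S.RegularOn f U ∧ T.RegularOn g V ∧ k = fun p => f p.1 * g p.2}

/-- The product (Zariski) topology of algebraic geometry on `X × Y`. -/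
abbrev prodTopology (S : FunctionSpace X) (T : FunctionSpace Y) : TopologicalSpace (X × Y) :=
  TopologicalSpace.generateFrom {D | ∃ U V, IsOpen[S.topology] U ∧ IsOpen[T.topology] V ∧
    ∃ h ∈ tensorFunctions S T U V, D = {p | p.1 ∈ U ∧ p.2 ∈ V ∧ h p ≠ 0}}

/-- The product of two spaces with functions: regular functions on `X × Y` are locally quotients
of finite sums `∑ f_k(x) g_k(y)` with `f_k` and `g_k` regular. -/
def prod (S : FunctionSpace X) (T : FunctionSpace Y) : FunctionSpace (X × Y) where
  topology := prodTopology S T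
  RegularAt f x := ∃ U V, IsOpen[S.topology] U ∧ IsOpen[T.topology] V ∧
    ∃ a ∈ tensorFunctions S T U V, ∃ h ∈ tensorFunctions S T U V, ∃ W : Set (X × Y),
      IsOpen[prodTopology S T] W ∧ x ∈ W ∧
        ∀ y ∈ W, y.1 ∈ U ∧ y.2 ∈ V ∧ h y ≠ 0 ∧ f y = a y / h y
  regularAt_congr := by
    rintro f g O x hO hxO hfg ⟨U, V, hU, hV, a, ha, h, hh, W, hW, hxW, H⟩
    refine ⟨U, V, hU, hV, a, ha, h, hh, W ∩ O, ?_, ⟨hxW, hxO⟩, fun y hy => ?_⟩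
    · exact @IsOpen.inter _ (prodTopology S T) W O hW hO
    · rw [← hfg y hy.2]
      exact H y hy.1
  regularAt_nhds := by
    rintro f x ⟨U, V, hU, hV, a, ha, h, hh, W, hW, hxW, H⟩
    exact ⟨W, hW, hxW, fun y hy => ⟨U, V, hU, hV, a, ha, h, hh, W, hW, hy, H⟩⟩

/-- A complex algebraic variety (reduced and separated, possibly reducible): it has a finite cover
by affine open subsets, and the diagonal is closed in the product. -/
structure IsVariety (S : FunctionSpace X) : Prop where
  exists_cover : ∃ (n : ℕ) (U : Fin n → Set X), (⋃ i, U i) = Set.univ ∧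
    ∀ i, ∃ hU : IsOpen[S.topology] (U i), (S.restrict (U i) hU).IsAffine
  separated : IsClosed[(S.prod S).topology] (Set.diagonal X)

end FunctionSpace

open FunctionSpace

section Maps

variable {X : Type u} {Y : Type v}

/-- Morphisms of varieties. -/
structure IsRegularMap (S : FunctionSpace X) (T : FunctionSpace Y) (φ : X → Y) : Prop where
  continuous : Continuous[S.topology, T.topology] φ
  regularAt_comp : ∀ (x : X) (f : Y → ℂ), T.RegularAt f (φ x) → S.RegularAt (f ∘ φ) x

/-- Antiholomorphic maps in the algebraic sense (antiregular maps): the pull back of a regular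
function is the complex conjugate of a regular function. -/
structure IsAntiregularMap (S : FunctionSpace X) (T : FunctionSpace Y) (φ : X → Y) : Prop where
  continuous : Continuous[S.topology, T.topology] φ
  regularAt_comp : ∀ (x : X) (f : Y → ℂ), T.RegularAt f (φ x) →
    S.RegularAt (fun y => (starRingEnd ℂ) (f (φ y))) x

end Maps

/-- A finite dimensional complex vector space as an affine variety: regular functions are locally
quotients of polynomial functions. -/
def vectorSpace (F : Type v) [AddCommGroup F] [Module ℂ F] : FunctionSpace F :=
  ofAlgebra (Algebra.adjoin ℂ (Set.range fun (l : Module.Dual ℂ F) (x : F) => l x))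

/-- `G`, with the structure `SG`, is a complex algebraic group. -/
structure IsAlgebraicGroup {G : Type u} [Group G] (SG : FunctionSpace G) : Prop where
  isVariety : SG.IsVariety
  regular_mul : IsRegularMap (SG.prod SG) SG fun p => p.1 * p.2
  regular_inv : IsRegularMap SG SG fun g => g⁻¹

/-- A real form of the algebraic group `G`: an antiregular involution that is a group
automorphism. -/
structure IsGroupRealForm {G : Type u} [Group G] (SG : FunctionSpace G) (σ : G →* G) : Prop where
  involutive : Function.Involutive σ
  antiregular : IsAntiregularMap SG SG σ

/-- The action map `G × Y → Y` is regular. -/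
def IsRegularAction {G : Type u} {Y : Type v} [Group G] [MulAction G Y]
    (SG : FunctionSpace G) (S : FunctionSpace Y) : Prop :=
  IsRegularMap (SG.prod S) S fun p => p.1 • p.2

/-- `Y` is a `G`-variety. -/
structure IsGVariety {G : Type u} {Y : Type v} [Group G] [MulAction G Y]
    (SG : FunctionSpace G) (S : FunctionSpace Y) : Prop where
  isVariety : S.IsVariety
  regular_action : IsRegularAction SG S

section Forms

variable {G : Type u} [Group G] {Y : Type v} [MulAction G Y]

/-- `μ` is an equivariant real form of the `G`-variety `Y`, compatible with `σ`. -/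
structure IsRealForm (σ : G →* G) (S : FunctionSpace Y) (μ : Y → Y) : Prop where
  involutive : Function.Involutive μ
  antiregular : IsAntiregularMap S S μ
  compatible : ∀ (g : G) (y : Y), μ (g • y) = σ g • μ y

variable (G) in
/-- `ψ` is a regular `G`-equivariant automorphism of `Y`. -/
structure IsGAut (S : FunctionSpace Y) (ψ : Y ≃ Y) : Prop where
  regular : IsRegularMap S S ψ
  regular_symm : IsRegularMap S S ψ.symm
  equivariant : ∀ (g : G) (y : Y), ψ (g • y) = g • ψ y

variable (G) in
/-- Equivalence of equivariant real forms of the `G`-variety `Y`. -/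
def RealFormEquiv (S : FunctionSpace Y) (μ₁ μ₂ : Y → Y) : Prop :=
  ∃ ψ : Y ≃ Y, IsGAut G S ψ ∧ μ₂ = ψ ∘ μ₁ ∘ ψ.symm

end Forms

section Bundles

variable {G : Type*} [Group G] {B : Type*} [MulAction G B]
  {F : Type*} [AddCommGroup F] [Module ℂ F] [DistribMulAction G F]

/-- `F` is a (rational) `G`-module: the linear action map `G × F → F` is regular. -/
structure IsGModule (SG : FunctionSpace G) (F : Type*) [AddCommGroup F] [Module ℂ F]
    [DistribMulAction G F] : Prop where
  smul_comm : ∀ (g : G) (c : ℂ) (v : F), g • (c • v) = c • (g • v)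
  regular_action : IsRegularAction SG (vectorSpace F)

/-- The total space `E = B × F` of the trivial bundle as a variety. The bundle projection is
`Prod.fst`, and `G` acts by `g • (b, v) = (g • b, g • v)`. -/
def totalSpace (SB : FunctionSpace B) (F : Type*) [AddCommGroup F] [Module ℂ F] :
    FunctionSpace (B × F) :=
  SB.prod (vectorSpace F)

/-- `μ` is a `G`-vector bundle real form of `E = B × F`, compatible with `σ` and `μB`: a real form
of `E` lying over `μB` and `ℝ`-linear from the fibre over `b` to the fibre over `μB b`. -/
structure IsBundleRealForm (σ : G →* G) (SB : FunctionSpace B) (μB : B → B)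
    (μ : B × F → B × F) : Prop where
  isRealForm : IsRealForm σ (totalSpace SB F) μ
  over_base : ∀ e : B × F, (μ e).1 = μB e.1
  fibre_linear : ∀ b : B, IsLinearMap ℝ fun v : F => (μ (b, v)).2

variable (G) in
/-- `ψ` is a `G`-vector bundle automorphism of `E = B × F`: a `G`-automorphism over the identity
of `B` that is linear on the fibres. -/
structure IsBundleAut (SB : FunctionSpace B) (ψ : B × F ≃ B × F) : Prop where
  isGAut : IsGAut G (totalSpace SB F) ψ
  over_base : ∀ e : B × F, (ψ e).1 = e.1
  fibre_linear : ∀ b : B, IsLinearMap ℂ fun v : F => (ψ (b, v)).2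

variable (G) in
/-- Equivalence of `G`-vector bundle real forms of `E = B × F`. -/
def BundleRealFormEquiv (SB : FunctionSpace B) (μ₁ μ₂ : B × F → B × F) : Prop :=
  ∃ ψ : B × F ≃ B × F, IsBundleAut G SB ψ ∧ μ₂ = ψ ∘ μ₁ ∘ ψ.symm

/-- `f^*μ = (f × id) ∘ μ ∘ (f × id)⁻¹`. -/
def pullbackForm (f : B ≃ B) (μ : B × F → B × F) : B × F → B × F :=
  f.prodCongr (Equiv.refl F) ∘ μ ∘ (f.prodCongr (Equiv.refl F)).symm

end Bundles

end EquivariantRealForms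

/-! A `G`-automorphism `ψ` of `E` preserves `E^H`, which is the zero section, so it restricts to a
`G`-automorphism `f` of `B`. If `ψ` conjugates `μ₁` to `μ₂`, then restricting to the zero section
shows that `f` commutes with `μB`. Now linearise `ψ`: let `L b` be the derivative at `0` of the
`F`-component of `v ↦ ψ (b, v)`. The chain rule makes `L b` invertible and `G`-equivariant. The real
forms are ℝ-linear on fibres, hence equal to their own fibre derivatives, so `L` intertwines `μ₁`
and `μ₂` over `f`. Then `(b, v) ↦ (b, L b v)` is a bundle automorphism conjugating `μ₁` to the
pullback of `μ₂` by `f⁻¹`. Conversely, a bundle equivalence composed with `(f × id)⁻¹` is an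
equivalence of equivariant real forms. `B` may be singular, so derivatives are taken along real
curves on which regular functions are differentiable. A real parameter also suits antiregular maps,
since conjugation preserves real differentiability. The `F`-component of `ψ` vanishes on the zero
section, so motion in the base contributes nothing to its derivative; this is the chain rule behind
`IsLinearization`. The main inputs are `exists_isLinearization`, `hasWeakDeriv_antiregular` and
`IsLinearization.comp_apply`. -/

namespace EquivariantRealForms

open scoped Topology

universe u v w

/-! ### Local rings of regular functions on varieties and on products. -/

namespace FunctionSpace

variable {X : Type u} {Y : Type v}

/-- The regular functions at each point form a local ring whose units are the functions that do
not vanish at the point. -/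
structure IsLocallyRinged (S : FunctionSpace X) : Prop where
  const : ∀ (c : ℂ) (x : X), S.RegularAt (fun _ => c) x
  add : ∀ {f g : X → ℂ} {x : X}, S.RegularAt f x → S.RegularAt g x →
    S.RegularAt (fun y => f y + g y) x
  mul : ∀ {f g : X → ℂ} {x : X}, S.RegularAt f x → S.RegularAt g x →
    S.RegularAt (fun y => f y * g y) x
  inv : ∀ {f : X → ℂ} {x : X}, S.RegularAt f x → f x ≠ 0 → S.RegularAt (fun y => (f y)⁻¹) x
  exists_isOpen_ne : ∀ {f : X → ℂ} {x : X}, S.RegularAt f x → f x ≠ 0 →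
    ∃ U : Set X, IsOpen[S.topology] U ∧ x ∈ U ∧ ∀ y ∈ U, f y ≠ 0

theorem IsLocallyRinged.sum {S : FunctionSpace X} (hS : S.IsLocallyRinged) {ι : Type*}
    (s : Finset ι) {f : ι → X → ℂ} {x : X} (hf : ∀ i, S.RegularAt (f i) x) :
    S.RegularAt (fun y => ∑ i ∈ s, f i y) x := by
  classical
  induction s using Finset.induction_on with
  | empty => simpa using hS.const 0 x
  | insert i s hi ih => simpa [Finset.sum_insert hi] using hS.add (hf i) ih

theorem IsLocallyRinged.sub {S : FunctionSpace X} (hS : S.IsLocallyRinged)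
    {f g : X → ℂ} {x : X} (hf : S.RegularAt f x) (hg : S.RegularAt g x) :
    S.RegularAt (fun y => f y - g y) x := by
  simpa [sub_eq_add_neg] using hS.add hf (hS.mul (hS.const (-1) x) hg)

theorem IsLocallyRinged.div {S : FunctionSpace X} (hS : S.IsLocallyRinged)
    {f g : X → ℂ} {x : X} (hf : S.RegularAt f x) (hg : S.RegularAt g x) (h : g x ≠ 0) :
    S.RegularAt (fun y => f y / g y) x := by
  simpa [div_eq_mul_inv] using hS.mul hf (hS.inv hg h)

theorem ofAlgebra_isOpen_ne (A : Subalgebra ℂ (X → ℂ)) {h : X → ℂ} (hh : h ∈ A) :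
    IsOpen[(ofAlgebra A).topology] {x | h x ≠ 0} :=
  TopologicalSpace.isOpen_generateFrom_of_mem ⟨h, hh, rfl⟩

theorem ofAlgebra_regularAt_of_mem (A : Subalgebra ℂ (X → ℂ)) {a : X → ℂ} (ha : a ∈ A) (x : X) :
    (ofAlgebra A).RegularAt a x :=
  ⟨a, ha, 1, A.one_mem, Set.univ, @isOpen_univ X (ofAlgebra A).topology, trivial,
    fun y _ => by simp⟩

theorem isLocallyRinged_ofAlgebra (A : Subalgebra ℂ (X → ℂ)) :
    (ofAlgebra A).IsLocallyRinged where
  const c x := ofAlgebra_regularAt_of_mem A (A.algebraMap_mem c) x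
  add := by
    rintro f g x ⟨a, ha, h, hh, W, hW, hx, H⟩ ⟨a', ha', h', hh', W', hW', hx', H'⟩
    refine ⟨a * h' + a' * h, A.add_mem (A.mul_mem ha hh') (A.mul_mem ha' hh), h * h',
      A.mul_mem hh hh', W ∩ W', @IsOpen.inter X (TopologicalSpace.generateFrom _) W W' hW hW',
      ⟨hx, hx'⟩, fun y hy => ?_⟩
    obtain ⟨h1, h2⟩ := H y hy.1
    obtain ⟨h3, h4⟩ := H' y hy.2
    refine ⟨mul_ne_zero h1 h3, ?_⟩
    simp only [h2, h4, Pi.add_apply, Pi.mul_apply]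
    field_simp
  mul := by
    rintro f g x ⟨a, ha, h, hh, W, hW, hx, H⟩ ⟨a', ha', h', hh', W', hW', hx', H'⟩
    refine ⟨a * a', A.mul_mem ha ha', h * h',
      A.mul_mem hh hh', W ∩ W', @IsOpen.inter X (TopologicalSpace.generateFrom _) W W' hW hW',
      ⟨hx, hx'⟩, fun y hy => ?_⟩
    obtain ⟨h1, h2⟩ := H y hy.1
    obtain ⟨h3, h4⟩ := H' y hy.2
    refine ⟨mul_ne_zero h1 h3, ?_⟩
    simp only [h2, h4, Pi.mul_apply]
    field_simp
  inv := by
    rintro f x ⟨a, ha, h, hh, W, hW, hx, H⟩ hf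
    refine ⟨h, hh, a, ha, W ∩ {y | a y ≠ 0}, @IsOpen.inter X (TopologicalSpace.generateFrom _) _ _
      hW (ofAlgebra_isOpen_ne A ha), ⟨hx, ?_⟩, fun y hy => ⟨hy.2, by simp [(H y hy.1).2]⟩⟩
    intro h0
    exact hf (by simp [(H x hx).2, h0])
  exists_isOpen_ne := by
    rintro f x ⟨a, ha, h, hh, W, hW, hx, H⟩ hf
    refine ⟨W ∩ {y | a y ≠ 0}, @IsOpen.inter X (TopologicalSpace.generateFrom _) _ _
      hW (ofAlgebra_isOpen_ne A ha), ⟨hx, ?_⟩, fun y hy => ?_⟩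
    · intro h0
      exact hf (by simp [(H x hx).2, h0])
    · rw [(H y hy.1).2]
      exact div_ne_zero hy.2 (H y hy.1).1

theorem restrict_regularAt_iff (S : FunctionSpace X) (U : Set X) (hU : IsOpen[S.topology] U)
    (f : X → ℂ) (x : U) : (S.restrict U hU).RegularAt (fun y => f y) x ↔ S.RegularAt f x :=
  ⟨fun ⟨g, hg, h⟩ => S.regularAt_congr g f U x hU x.2 (fun y hy => (h ⟨y, hy⟩).symm) hg,
    fun h => ⟨f, h, fun _ => rfl⟩⟩

/-- All the axioms are local, and a germ is regular on an open piece exactly when it is regular on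
the whole space, so they pass from affine charts to `X`. -/
theorem IsVariety.isLocallyRinged {S : FunctionSpace X} (hS : S.IsVariety) :
    S.IsLocallyRinged := by
  obtain ⟨n, U, hUX, hU⟩ := hS.exists_cover
  have key : ∀ x : X, ∃ (U : Set X) (hU : IsOpen[S.topology] U),
      x ∈ U ∧ (S.restrict U hU).IsLocallyRinged := fun x => by
    obtain ⟨i, hi⟩ := Set.mem_iUnion.1 (hUX ▸ Set.mem_univ x : x ∈ ⋃ i, U i)
    obtain ⟨hUi, m, φ, -, -, h⟩ := hU i
    exact ⟨U i, hUi, hi, h ▸ isLocallyRinged_ofAlgebra _⟩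
  constructor
  · intro c x
    obtain ⟨U, hU, hx, h⟩ := key x
    exact (S.restrict_regularAt_iff U hU _ ⟨x, hx⟩).1 (h.const c _)
  · intro f g x hf hg
    obtain ⟨U, hU, hx, h⟩ := key x
    rw [← S.restrict_regularAt_iff U hU _ ⟨x, hx⟩] at hf hg ⊢
    exact h.add hf hg
  · intro f g x hf hg
    obtain ⟨U, hU, hx, h⟩ := key x
    rw [← S.restrict_regularAt_iff U hU _ ⟨x, hx⟩] at hf hg ⊢
    exact h.mul hf hg
  · intro f x hf h0
    obtain ⟨U, hU, hx, h⟩ := key x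
    rw [← S.restrict_regularAt_iff U hU _ ⟨x, hx⟩] at hf ⊢
    exact h.inv hf h0
  · intro f x hf h0
    obtain ⟨U, hU, hx, h⟩ := key x
    rw [← S.restrict_regularAt_iff U hU _ ⟨x, hx⟩] at hf
    obtain ⟨V, ⟨V', hV', rfl⟩, hxV, H⟩ := h.exists_isOpen_ne hf h0
    exact ⟨V' ∩ U, @IsOpen.inter X S.topology _ _ hV' hU, ⟨hxV, hx⟩,
      fun y hy => H ⟨y, hy.2⟩ hy.1⟩

section Prod

variable {S : FunctionSpace X} {T : FunctionSpace Y}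

theorem tensorFunctions_anti {U U' : Set X} {V V' : Set Y} (hU : U' ⊆ U) (hV : V' ⊆ V) :
    tensorFunctions S T U V ≤ tensorFunctions S T U' V' :=
  Submodule.span_mono fun _ ⟨f, g, hf, hg, h⟩ =>
    ⟨f, g, fun x hx => hf x (hU hx), fun y hy => hg y (hV hy), h⟩

theorem mul_mem_tensorFunctions (hS : S.IsLocallyRinged) (hT : T.IsLocallyRinged)
    {U : Set X} {V : Set Y} {a b : X × Y → ℂ} (ha : a ∈ tensorFunctions S T U V)
    (hb : b ∈ tensorFunctions S T U V) : a * b ∈ tensorFunctions S T U V := by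
  have h := Submodule.mul_mem_mul ha hb
  rw [tensorFunctions, Submodule.span_mul_span] at h
  refine Submodule.span_mono ?_ h
  rintro _ ⟨_, ⟨f, g, hf, hg, rfl⟩, _, ⟨f', g', hf', hg', rfl⟩, rfl⟩
  refine ⟨_, _, fun x hx => hS.mul (hf x hx) (hf' x hx), fun y hy => hT.mul (hg y hy) (hg' y hy),
    ?_⟩
  funext p
  simp only [Pi.mul_apply]
  ring

theorem const_mem_tensorFunctions (hS : S.IsLocallyRinged) (hT : T.IsLocallyRinged)
    (U : Set X) (V : Set Y) (c : ℂ) : (fun _ => c) ∈ tensorFunctions S T U V :=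
  Submodule.subset_span ⟨_, _, fun x _ => hS.const c x, fun y _ => hT.const 1 y, by simp⟩

theorem prod_isOpen_ne {U : Set X} {V : Set Y} (hU : IsOpen[S.topology] U)
    (hV : IsOpen[T.topology] V) {h : X × Y → ℂ} (hh : h ∈ tensorFunctions S T U V) :
    IsOpen[(S.prod T).topology] {p | p.1 ∈ U ∧ p.2 ∈ V ∧ h p ≠ 0} :=
  TopologicalSpace.isOpen_generateFrom_of_mem ⟨U, V, hU, hV, h, hh, rfl⟩

/-- Two germs may be written as quotients over different boxes `U × V`; on the intersection of the
boxes the usual fraction arithmetic applies, because tensor functions are closed under products. -/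
theorem isLocallyRinged_prod (hS : S.IsLocallyRinged) (hT : T.IsLocallyRinged) :
    (S.prod T).IsLocallyRinged where
  const c x := ⟨Set.univ, Set.univ, @isOpen_univ X S.topology, @isOpen_univ Y T.topology,
    _, const_mem_tensorFunctions hS hT _ _ c, _, const_mem_tensorFunctions hS hT _ _ 1, Set.univ,
    @isOpen_univ _ (prodTopology S T), trivial, fun y _ => by simp⟩
  add := by
    rintro f g x ⟨U, V, hU, hV, a, ha, h, hh, W, hW, hx, H⟩
      ⟨U', V', hU', hV', a', ha', h', hh', W', hW', hx', H'⟩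
    have iU := @Set.inter_subset_left X U U'
    have iV := @Set.inter_subset_left Y V V'
    have iU' := @Set.inter_subset_right X U U'
    have iV' := @Set.inter_subset_right Y V V'
    refine ⟨U ∩ U', V ∩ V', @IsOpen.inter X S.topology _ _ hU hU',
      @IsOpen.inter Y T.topology _ _ hV hV', a * h' + a' * h,
      Submodule.add_mem _
        (mul_mem_tensorFunctions hS hT (tensorFunctions_anti iU iV ha)
          (tensorFunctions_anti iU' iV' hh'))
        (mul_mem_tensorFunctions hS hT (tensorFunctions_anti iU' iV' ha')
          (tensorFunctions_anti iU iV hh)), h * h',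
      mul_mem_tensorFunctions hS hT (tensorFunctions_anti iU iV hh)
          (tensorFunctions_anti iU' iV' hh'),
      W ∩ W', @IsOpen.inter _ (prodTopology S T) W W' hW hW', ⟨hx, hx'⟩, fun y hy => ?_⟩
    obtain ⟨u1, v1, h1, h2⟩ := H y hy.1
    obtain ⟨u2, v2, h3, h4⟩ := H' y hy.2
    refine ⟨⟨u1, u2⟩, ⟨v1, v2⟩, mul_ne_zero h1 h3, ?_⟩
    simp only [h2, h4, Pi.add_apply, Pi.mul_apply]
    field_simp
  mul := by
    rintro f g x ⟨U, V, hU, hV, a, ha, h, hh, W, hW, hx, H⟩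
      ⟨U', V', hU', hV', a', ha', h', hh', W', hW', hx', H'⟩
    have iU := @Set.inter_subset_left X U U'
    have iV := @Set.inter_subset_left Y V V'
    have iU' := @Set.inter_subset_right X U U'
    have iV' := @Set.inter_subset_right Y V V'
    refine ⟨U ∩ U', V ∩ V', @IsOpen.inter X S.topology _ _ hU hU',
      @IsOpen.inter Y T.topology _ _ hV hV', a * a',
      mul_mem_tensorFunctions hS hT (tensorFunctions_anti iU iV ha)
          (tensorFunctions_anti iU' iV' ha'), h * h',
      mul_mem_tensorFunctions hS hT (tensorFunctions_anti iU iV hh)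
          (tensorFunctions_anti iU' iV' hh'),
      W ∩ W', @IsOpen.inter _ (prodTopology S T) W W' hW hW', ⟨hx, hx'⟩, fun y hy => ?_⟩
    obtain ⟨u1, v1, h1, h2⟩ := H y hy.1
    obtain ⟨u2, v2, h3, h4⟩ := H' y hy.2
    refine ⟨⟨u1, u2⟩, ⟨v1, v2⟩, mul_ne_zero h1 h3, ?_⟩
    simp only [h2, h4, Pi.mul_apply]
    field_simp
  inv := by
    rintro f x ⟨U, V, hU, hV, a, ha, h, hh, W, hW, hx, H⟩ hf
    refine ⟨U, V, hU, hV, h, hh, a, ha, W ∩ {p | p.1 ∈ U ∧ p.2 ∈ V ∧ a p ≠ 0},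
      @IsOpen.inter _ (prodTopology S T) _ _ hW (prod_isOpen_ne hU hV ha),
      ⟨hx, (H x hx).1, (H x hx).2.1, ?_⟩,
      fun y hy => ⟨hy.2.1, hy.2.2.1, hy.2.2.2, by simp [(H y hy.1).2.2.2]⟩⟩
    intro h0
    exact hf (by simp [(H x hx).2.2.2, h0])
  exists_isOpen_ne := by
    rintro f x ⟨U, V, hU, hV, a, ha, h, hh, W, hW, hx, H⟩ hf
    refine ⟨W ∩ {p | p.1 ∈ U ∧ p.2 ∈ V ∧ a p ≠ 0},
      @IsOpen.inter _ (prodTopology S T) _ _ hW (prod_isOpen_ne hU hV ha),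
      ⟨hx, (H x hx).1, (H x hx).2.1, ?_⟩, fun y hy => ?_⟩
    · intro h0
      exact hf (by simp [(H x hx).2.2.2, h0])
    · rw [(H y hy.1).2.2.2]
      exact div_ne_zero hy.2.2.2 (H y hy.1).2.2.1

end Prod

end FunctionSpace

open FunctionSpace

/-! ### Regular maps into products and affine spaces. -/

section RegularMaps

variable {X : Type u} {Y : Type v} {Z : Type w}
  {S : FunctionSpace X} {T : FunctionSpace Y} {R : FunctionSpace Z}

theorem continuous_generateFrom_of_nhds {φ : X → Y} {g : Set (Set Y)}
    (h : ∀ s ∈ g, ∀ x, φ x ∈ s → ∃ U, IsOpen[S.topology] U ∧ x ∈ U ∧ ∀ y ∈ U, φ y ∈ s) :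
    Continuous[S.topology, TopologicalSpace.generateFrom g] φ := by
  let _ := S.topology
  refine continuous_generateFrom_iff.2 fun s hs => isOpen_iff_forall_mem_open.2 fun x hx => ?_
  obtain ⟨U, hU, hxU, H⟩ := h s hs x hx
  exact ⟨U, H, hU, hxU⟩

theorem IsRegularMap.id : IsRegularMap S S fun x => x where
  continuous := @continuous_id X S.topology
  regularAt_comp _ _ hf := hf

theorem IsRegularMap.comp {ψ : Y → Z} {φ : X → Y} (hψ : IsRegularMap T R ψ)
    (hφ : IsRegularMap S T φ) : IsRegularMap S R (ψ ∘ φ) where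
  continuous := @Continuous.comp X Y Z S.topology T.topology R.topology φ ψ hψ.continuous
    hφ.continuous
  regularAt_comp x f hf := hφ.regularAt_comp x _ (hψ.regularAt_comp (φ x) f hf)

theorem isRegularMap_const (hS : S.IsLocallyRinged)
    (y : Y) : IsRegularMap S T fun _ => y where
  continuous := @continuous_const X Y S.topology T.topology y
  regularAt_comp x f _ := hS.const (f y) x

theorem isRegularMap_fst (hS : S.IsLocallyRinged) (hT : T.IsLocallyRinged) :
    IsRegularMap (S.prod T) S Prod.fst := by
  have mem : ∀ {f : X → ℂ} {U : Set X}, S.RegularOn f U →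
      (fun p : X × Y => f p.1) ∈ tensorFunctions S T U Set.univ := fun hf =>
    Submodule.subset_span ⟨_, _, hf, fun y _ => hT.const 1 y, by simp⟩
  have op : ∀ {U : Set X}, IsOpen[S.topology] U →
      IsOpen[(S.prod T).topology] {p : X × Y | p.1 ∈ U} := fun {U} hU => by
    simpa using prod_isOpen_ne hU (@isOpen_univ Y T.topology)
      (mem fun x _ => hS.const 1 x : _ ∈ tensorFunctions S T U Set.univ)
  refine ⟨@Continuous.mk _ _ (S.prod T).topology S.topology _ fun U hU => op hU, fun x f hf => ?_⟩
  obtain ⟨U, hU, hx, H⟩ := S.regularAt_nhds f _ hf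
  exact ⟨U, Set.univ, hU, @isOpen_univ Y T.topology, _, mem H, _,
    const_mem_tensorFunctions hS hT _ _ 1, _, op hU, hx,
    fun y hy => ⟨hy, trivial, one_ne_zero, by simp⟩⟩

theorem isRegularMap_snd (hS : S.IsLocallyRinged) (hT : T.IsLocallyRinged) :
    IsRegularMap (S.prod T) T Prod.snd := by
  have mem : ∀ {f : Y → ℂ} {U : Set Y}, T.RegularOn f U →
      (fun p : X × Y => f p.2) ∈ tensorFunctions S T Set.univ U := fun hf =>
    Submodule.subset_span ⟨_, _, fun y _ => hS.const 1 y, hf, by simp⟩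
  have op : ∀ {U : Set Y}, IsOpen[T.topology] U →
      IsOpen[(S.prod T).topology] {p : X × Y | p.2 ∈ U} := fun {U} hU => by
    simpa using prod_isOpen_ne (@isOpen_univ X S.topology) hU
      (mem fun x _ => hT.const 1 x : _ ∈ tensorFunctions S T Set.univ U)
  refine ⟨@Continuous.mk _ _ (S.prod T).topology T.topology _ fun U hU => op hU, fun x f hf => ?_⟩
  obtain ⟨U, hU, hx, H⟩ := T.regularAt_nhds f _ hf
  exact ⟨Set.univ, U, @isOpen_univ X S.topology, hU, _, mem H, _,
    const_mem_tensorFunctions hS hT _ _ 1, _, op hU, hx,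
    fun y hy => ⟨trivial, hy, one_ne_zero, by simp⟩⟩

/-- The topology on the product is finer than the product of the topologies. Continuity therefore
needs regularity of pulled-back tensor functions first: their non-vanishing loci are then
neighbourhoods. -/
theorem IsRegularMap.prodMk (hR : R.IsLocallyRinged) {φ : Z → X} {ψ : Z → Y}
    (hφ : IsRegularMap R S φ) (hψ : IsRegularMap R T ψ) :
    IsRegularMap R (S.prod T) fun z => (φ z, ψ z) := by
  have reg : ∀ {U V} {a : X × Y → ℂ}, a ∈ tensorFunctions S T U V → ∀ z, φ z ∈ U → ψ z ∈ V →
      R.RegularAt (fun z => a (φ z, ψ z)) z := fun {U V a} ha z hU hV => by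
    induction ha using Submodule.span_induction with
    | mem a h =>
      obtain ⟨f, g, hf, hg, rfl⟩ := h
      exact hR.mul (hφ.regularAt_comp z f (hf _ hU)) (hψ.regularAt_comp z g (hg _ hV))
    | zero => exact hR.const 0 z
    | add a b _ _ ha hb => exact hR.add ha hb
    | smul c a _ ha => exact hR.mul (hR.const c z) ha
  have hc : Continuous[R.topology, (S.prod T).topology] fun z => (φ z, ψ z) := by
    refine continuous_generateFrom_of_nhds ?_
    rintro _ ⟨U, V, hU, hV, h, hh, rfl⟩ z ⟨hzU, hzV, hz⟩
    obtain ⟨W, hW, hzW, H⟩ := hR.exists_isOpen_ne (reg hh z hzU hzV) hz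
    let _ := R.topology
    let _ := S.topology
    let _ := T.topology
    exact ⟨W ∩ (φ ⁻¹' U ∩ ψ ⁻¹' V),
      hW.inter ((hU.preimage hφ.continuous).inter (hV.preimage hψ.continuous)),
      ⟨hzW, hzU, hzV⟩, fun y hy => ⟨hy.2.1, hy.2.2, H y hy.1⟩⟩
  refine ⟨hc, ?_⟩
  rintro z f ⟨U, V, hU, hV, a, ha, h, hh, W, hW, hx, H⟩
  obtain ⟨h1, h2, h3, h4⟩ := H _ hx
  exact R.regularAt_congr _ _ _ z (@Continuous.isOpen_preimage _ _ R.topology (S.prod T).topology _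
    hc W hW) hx (fun y hy => ((H _ hy).2.2.2).symm) (hR.div (reg ha z h1 h2) (reg hh z h1 h2) h3)

theorem isRegularMap_ofAlgebra (hS : S.IsLocallyRinged) {s : Set (Y → ℂ)} {φ : X → Y}
    (h : ∀ l ∈ s, ∀ x, S.RegularAt (fun y => l (φ y)) x) :
    IsRegularMap S (ofAlgebra (Algebra.adjoin ℂ s)) φ := by
  have reg : ∀ a ∈ Algebra.adjoin ℂ s, ∀ x, S.RegularAt (fun y => a (φ y)) x := fun a ha => by
    induction ha using Algebra.adjoin_induction with
    | mem l hl => exact h l hl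
    | algebraMap c => exact fun x => hS.const c x
    | add a b _ _ ha hb => exact fun x => hS.add (ha x) (hb x)
    | mul a b _ _ ha hb => exact fun x => hS.mul (ha x) (hb x)
  have hc : Continuous[S.topology, (ofAlgebra (Algebra.adjoin ℂ s)).topology] φ := by
    refine continuous_generateFrom_of_nhds ?_
    rintro _ ⟨a, ha, rfl⟩ x hx
    exact hS.exists_isOpen_ne (reg a ha x) hx
  refine ⟨hc, ?_⟩
  rintro x f ⟨a, ha, k, hk, W, hW, hx, H⟩
  exact S.regularAt_congr _ _ _ x (@Continuous.isOpen_preimage _ _ S.topology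
    (ofAlgebra (Algebra.adjoin ℂ s)).topology _ hc W hW) hx (fun y hy => ((H _ hy).2).symm)
    (hS.div (reg a ha x) (reg k hk x) (H _ hx).1)

end RegularMaps

section VectorSpace

variable {X : Type u} {S : FunctionSpace X} {F : Type v} [AddCommGroup F] [Module ℂ F]

theorem vectorSpace_isLocallyRinged : (vectorSpace F).IsLocallyRinged :=
  isLocallyRinged_ofAlgebra _

theorem vectorSpace_regularAt_dual (l : Module.Dual ℂ F) (x : F) :
    (vectorSpace F).RegularAt (fun y => l y) x :=
  ofAlgebra_regularAt_of_mem _ (Algebra.subset_adjoin (Set.mem_range_self l)) x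

theorem isRegularMap_vectorSpace (hS : S.IsLocallyRinged) {φ : X → F}
    (h : ∀ (l : Module.Dual ℂ F) (x : X), S.RegularAt (fun y => l (φ y)) x) :
    IsRegularMap S (vectorSpace F) φ :=
  isRegularMap_ofAlgebra hS (by rintro _ ⟨l, rfl⟩; exact h l)

end VectorSpace

/-! ### Real curves along which regular functions are differentiable. -/

section Curves

variable {X : Type u} {Y : Type v} {S : FunctionSpace X} {T : FunctionSpace Y}

/-- The germ at `0` of a curve `ℝ → X` that is continuous at `0` for the Zariski topology and along
which the regular functions are differentiable at `0`. -/
structure IsSmoothCurve (S : FunctionSpace X) (γ : ℝ → X) : Prop where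
  eventually_mem : ∀ U : Set X, IsOpen[S.topology] U → γ 0 ∈ U → ∀ᶠ t in 𝓝 0, γ t ∈ U
  differentiableAt : ∀ f : X → ℂ, S.RegularAt f (γ 0) → DifferentiableAt ℝ (fun t => f (γ t)) 0

theorem isSmoothCurve_const (x : X) : IsSmoothCurve S fun _ => x :=
  ⟨fun _ _ h => Filter.Eventually.of_forall fun _ => h, fun f _ => differentiableAt_const (f x)⟩

theorem IsSmoothCurve.map_regular {γ : ℝ → X} (hγ : IsSmoothCurve S γ) {φ : X → Y}
    (hφ : IsRegularMap S T φ) : IsSmoothCurve T fun t => φ (γ t) :=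
  ⟨fun U hU h => hγ.eventually_mem (φ ⁻¹' U)
      (@Continuous.isOpen_preimage _ _ S.topology T.topology _ hφ.continuous U hU) h,
    fun f hf => hγ.differentiableAt _ (hφ.regularAt_comp _ f hf)⟩

theorem eventually_ne_of_differentiableAt {f : ℝ → ℂ} (hf : DifferentiableAt ℝ f 0)
    (h : f 0 ≠ 0) : ∀ᶠ t in 𝓝 0, f t ≠ 0 :=
  hf.continuousAt.eventually_ne h

theorem eventually_mem_of_generateFrom {g : Set (Set X)} {γ : ℝ → X}
    (h : ∀ s ∈ g, γ 0 ∈ s → ∀ᶠ t in 𝓝 0, γ t ∈ s) {U : Set X}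
    (hU : IsOpen[TopologicalSpace.generateFrom g] U) (h0 : γ 0 ∈ U) : ∀ᶠ t in 𝓝 0, γ t ∈ U := by
  let _ := TopologicalSpace.generateFrom g
  have : Filter.Tendsto γ (𝓝 0) (𝓝 (γ 0)) := TopologicalSpace.tendsto_nhds_generateFrom_iff.2 h
  exact this.eventually (hU.mem_nhds h0)

/-- Tensor functions are differentiable along the pair by the product rule, hence stay nonzero for
small `t`; this handles the basic open sets of the product. -/
theorem IsSmoothCurve.prodMk {γ : ℝ → X} {δ : ℝ → Y} (hγ : IsSmoothCurve S γ)
    (hδ : IsSmoothCurve T δ) : IsSmoothCurve (S.prod T) fun t => (γ t, δ t) := by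
  have diff : ∀ {U V} {a : X × Y → ℂ}, a ∈ tensorFunctions S T U V → γ 0 ∈ U → δ 0 ∈ V →
      DifferentiableAt ℝ (fun t => a (γ t, δ t)) 0 := fun {U V a} ha hU hV => by
    induction ha using Submodule.span_induction with
    | mem a h =>
      obtain ⟨f, g, hf, hg, rfl⟩ := h
      exact (hγ.differentiableAt f (hf _ hU)).mul (hδ.differentiableAt g (hg _ hV))
    | zero => exact differentiableAt_const (0 : ℂ)
    | add a b _ _ ha hb => exact ha.add hb
    | smul c a _ ha => exact ha.const_mul c
  have ev : ∀ W : Set (X × Y), IsOpen[(S.prod T).topology] W → (γ 0, δ 0) ∈ W →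
      ∀ᶠ t in 𝓝 0, (γ t, δ t) ∈ W := fun W hW h0 => by
    refine eventually_mem_of_generateFrom (γ := fun t => (γ t, δ t)) ?_ hW h0
    rintro _ ⟨U, V, hU, hV, h, hh, rfl⟩ ⟨h1, h2, h3⟩
    exact (hγ.eventually_mem U hU h1).and ((hδ.eventually_mem V hV h2).and
      (eventually_ne_of_differentiableAt (diff hh h1 h2) h3))
  refine ⟨ev, ?_⟩
  rintro f ⟨U, V, hU, hV, a, ha, h, hh, W, hW, hx, H⟩
  obtain ⟨h1, h2, h3, h4⟩ := H _ hx
  refine ((diff ha h1 h2).fun_div (diff hh h1 h2) h3).congr_of_eventuallyEq ?_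
  filter_upwards [ev W hW hx] with t ht using (H _ ht).2.2.2

end Curves

/-! ### Derivatives of curves in a vector space, tested on linear forms. -/

section VectorCurves

variable {F : Type v} [AddCommGroup F] [Module ℂ F]

/-- The curve `w` in the vector space `F` has derivative `u` at `0`, tested on linear forms. -/
def HasWeakDeriv (w : ℝ → F) (u : F) : Prop :=
  ∀ l : Module.Dual ℂ F, HasDerivAt (fun t => l (w t)) (l u) 0

theorem HasWeakDeriv.unique {w : ℝ → F} {u u' : F} (h : HasWeakDeriv w u)
    (h' : HasWeakDeriv w u') : u = u' := by
  refine sub_eq_zero.1 ((Module.forall_dual_apply_eq_zero_iff ℂ _).1 fun l => ?_)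
  rw [map_sub, (h l).unique (h' l), sub_self]

theorem hasWeakDeriv_smul (v : F) : HasWeakDeriv (fun t : ℝ => (t : ℂ) • v) v := fun l => by
  simpa using (Complex.ofRealCLM.hasDerivAt (x := 0)).mul_const (l v)

theorem HasWeakDeriv.map {w : ℝ → F} {u : F} (h : HasWeakDeriv w u) (A : F →ₗ[ℂ] F) :
    HasWeakDeriv (fun t => A (w t)) (A u) := fun l => h (l ∘ₗ A)

/-- `D` is the differential at `x` of a polynomial function, built by the Leibniz rule. The point is
that one linear form serves all curves through `x`. -/
theorem HasWeakDeriv.exists_hasDerivAt_of_mem_adjoin {a : F → ℂ}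
    (ha : a ∈ Algebra.adjoin ℂ (Set.range fun (l : Module.Dual ℂ F) (x : F) => l x)) (x : F) :
    ∃ D : Module.Dual ℂ F, ∀ (w : ℝ → F) (u : F), w 0 = x → HasWeakDeriv w u →
      HasDerivAt (fun t => a (w t)) (D u) 0 := by
  induction ha using Algebra.adjoin_induction with
  | mem l hl =>
    obtain ⟨l, rfl⟩ := hl
    exact ⟨l, fun w u _ h => h l⟩
  | algebraMap c => exact ⟨0, fun w u _ _ => hasDerivAt_const (0 : ℝ) c⟩
  | add a b _ _ ha hb =>
    obtain ⟨D, hD⟩ := ha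
    obtain ⟨E, hE⟩ := hb
    exact ⟨D + E, fun w u h0 h => (hD w u h0 h).add (hE w u h0 h)⟩
  | mul a b _ _ ha hb =>
    obtain ⟨D, hD⟩ := ha
    obtain ⟨E, hE⟩ := hb
    refine ⟨b x • D + a x • E, fun w u h0 h => ?_⟩
    refine ((hD w u h0 h).mul (hE w u h0 h)).congr_deriv ?_
    simp only [h0, LinearMap.add_apply, LinearMap.smul_apply, smul_eq_mul]
    ring

theorem HasWeakDeriv.isSmoothCurve {w : ℝ → F} {u : F} (h : HasWeakDeriv w u) :
    IsSmoothCurve (vectorSpace F) w := by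
  have diff : ∀ a ∈ Algebra.adjoin ℂ (Set.range fun (l : Module.Dual ℂ F) (x : F) => l x),
      DifferentiableAt ℝ (fun t => a (w t)) 0 := fun a ha => by
    obtain ⟨D, hD⟩ := HasWeakDeriv.exists_hasDerivAt_of_mem_adjoin ha (w 0)
    exact (hD w u rfl h).differentiableAt
  have ev : ∀ W : Set F, IsOpen[(vectorSpace F).topology] W → w 0 ∈ W →
      ∀ᶠ t in 𝓝 0, w t ∈ W := fun W hW h0 => by
    refine eventually_mem_of_generateFrom ?_ hW h0
    rintro _ ⟨a, ha, rfl⟩ h0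
    exact eventually_ne_of_differentiableAt (diff a ha) h0
  refine ⟨ev, ?_⟩
  rintro f ⟨a, ha, k, hk, W, hW, hx, H⟩
  refine ((diff a ha).fun_div (diff k hk) (H _ hx).1).congr_of_eventuallyEq ?_
  filter_upwards [ev W hW hx] with t ht using (H _ ht).2

theorem exists_dual_hasDerivAt_of_regularAt {g : F → ℂ} {x : F}
    (hg : (vectorSpace F).RegularAt g x) :
    ∃ D : Module.Dual ℂ F, ∀ (w : ℝ → F) (u : F), w 0 = x → HasWeakDeriv w u →
      HasDerivAt (fun t => g (w t)) (D u) 0 := by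
  obtain ⟨a, ha, k, hk, W, hW, hx, H⟩ := hg
  obtain ⟨D, hD⟩ := HasWeakDeriv.exists_hasDerivAt_of_mem_adjoin ha x
  obtain ⟨E, hE⟩ := HasWeakDeriv.exists_hasDerivAt_of_mem_adjoin hk x
  refine ⟨(k x ^ 2)⁻¹ • (k x • D - a x • E), fun w u h0 h => ?_⟩
  have hd := (hD w u h0 h).fun_div (hE w u h0 h) (by rw [h0]; exact (H _ hx).1)
  refine (hd.congr_of_eventuallyEq ?_).congr_deriv ?_
  · filter_upwards [h.isSmoothCurve.eventually_mem W hW (by rwa [h0])] with t ht using (H _ ht).2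
  · simp [h0]
    ring

end VectorCurves

/-! ### Fibre derivatives along the zero section. -/

section NormalDerivative

variable {B : Type u} {SB : FunctionSpace B} {F : Type v} [AddCommGroup F] [Module ℂ F]

/-- The family `D` of linear forms, with coefficients regular on `U`, is the derivative of `φ` along
the zero section in the direction of the fibres. -/
structure IsNormalDerivative (SB : FunctionSpace B) (φ : B × F → ℂ) (U : Set B)
    (D : B → Module.Dual ℂ F) : Prop where
  regularOn : ∀ v, SB.RegularOn (fun b => D b v) U
  hasDerivAt : ∀ (γ : ℝ → B) (w : ℝ → F) (u : F), IsSmoothCurve SB γ → γ 0 ∈ U → w 0 = 0 →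
    HasWeakDeriv w u → ∃ c : ℂ, HasDerivAt (fun t => φ (γ t, 0)) c 0 ∧
      HasDerivAt (fun t => φ (γ t, w t)) (c + D (γ 0) u) 0

/-- For `f(b) g(v)` the fibre derivative is `f(b)` times the differential of `g` at `0`, visibly
regular in `b`; the remaining term of the product rule is the derivative along the projected curve
in the zero section. -/
theorem exists_isNormalDerivative_of_mem_tensorFunctions (hB : SB.IsLocallyRinged) {U : Set B}
    {V : Set F} (hV : 0 ∈ V) {a : B × F → ℂ}
    (ha : a ∈ tensorFunctions SB (vectorSpace F) U V) : ∃ D, IsNormalDerivative SB a U D := by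
  induction ha using Submodule.span_induction with
  | mem a h =>
    obtain ⟨f, g, hf, hg, rfl⟩ := h
    obtain ⟨D, hD⟩ := exists_dual_hasDerivAt_of_regularAt (hg 0 hV)
    refine ⟨fun b => f b • D, fun v b hb => hB.mul (hf b hb) (hB.const (D v) b),
      fun γ w u hγ h0 hw h => ?_⟩
    have hd := (hγ.differentiableAt f (hf _ h0)).hasDerivAt
    refine ⟨_, hd.mul_const (g 0), (hd.fun_mul (hD w u hw h)).congr_deriv ?_⟩
    simp [hw]
  | zero =>
    exact ⟨fun _ => 0, fun v b _ => hB.const 0 b, fun γ w u _ _ _ _ =>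
      ⟨0, hasDerivAt_const (0 : ℝ) (0 : ℂ), by simpa using hasDerivAt_const (0 : ℝ) (0 : ℂ)⟩⟩
  | add a b _ _ ha hb =>
    obtain ⟨D, hD⟩ := ha
    obtain ⟨E, hE⟩ := hb
    refine ⟨fun b => D b + E b, fun v b hb => hB.add (hD.regularOn v b hb) (hE.regularOn v b hb),
      fun γ w u hγ h0 hw h => ?_⟩
    obtain ⟨c, hc, hc'⟩ := hD.hasDerivAt γ w u hγ h0 hw h
    obtain ⟨d, hd, hd'⟩ := hE.hasDerivAt γ w u hγ h0 hw h
    refine ⟨c + d, hc.add hd, (hc'.add hd').congr_deriv ?_⟩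
    simp only [LinearMap.add_apply]
    ring
  | smul r a _ ha =>
    obtain ⟨D, hD⟩ := ha
    refine ⟨fun b => r • D b, fun v b hb => hB.mul (hB.const r b) (hD.regularOn v b hb),
      fun γ w u hγ h0 hw h => ?_⟩
    obtain ⟨c, hc, hc'⟩ := hD.hasDerivAt γ w u hγ h0 hw h
    refine ⟨r * c, hc.const_mul r, (hc'.const_mul r).congr_deriv ?_⟩
    simp only [LinearMap.smul_apply, smul_eq_mul]
    ring

theorem isRegularMap_zeroSection (hB : SB.IsLocallyRinged) :
    IsRegularMap SB (totalSpace SB F) fun b => (b, 0) :=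
  IsRegularMap.id.prodMk hB (isRegularMap_const hB 0)

theorem exists_isNormalDerivative (hB : SB.IsLocallyRinged) {φ : B × F → ℂ} {b : B}
    (hφ : (totalSpace SB F).RegularAt φ (b, 0)) :
    ∃ U, IsOpen[SB.topology] U ∧ b ∈ U ∧ ∃ D, IsNormalDerivative SB φ U D := by
  obtain ⟨U, V, hU, hV, a, ha, k, hk, W, hW, hx, H⟩ := hφ
  have hV0 := (H _ hx).2.1
  obtain ⟨D, hD⟩ := exists_isNormalDerivative_of_mem_tensorFunctions hB hV0 ha
  obtain ⟨E, hE⟩ := exists_isNormalDerivative_of_mem_tensorFunctions hB hV0 hk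
  have hz := isRegularMap_zeroSection (F := F) hB
  -- Numerator and denominator restrict to regular functions on the zero section, so the
  -- coefficients given by the quotient rule are regular.
  have reg : ∀ a ∈ tensorFunctions SB (vectorSpace F) U V, ∀ c, (c, 0) ∈ W →
      SB.RegularAt (fun c => a (c, 0)) c := fun a ha c hc =>
    hz.regularAt_comp c a ⟨U, V, hU, hV, a, ha, _,
      const_mem_tensorFunctions hB vectorSpace_isLocallyRinged _ _ 1, W, hW, hc, fun y hy =>
        ⟨(H y hy).1, (H y hy).2.1, one_ne_zero, by simp⟩⟩
  refine ⟨{c | (c, 0) ∈ W}, @Continuous.isOpen_preimage _ _ SB.topology (totalSpace SB F).topology _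
    hz.continuous W hW, hx, fun c => (k (c, 0) ^ 2)⁻¹ • (k (c, 0) • D c - a (c, 0) • E c),
    fun v c hc => ?_, fun γ w u hγ h0 hw h => ?_⟩
  · obtain ⟨h1, h2, h3, h4⟩ := H _ hc
    have hkc := reg k hk c hc
    have := hB.mul (hB.inv (hB.mul hkc hkc) (mul_ne_zero h3 h3))
      (hB.sub (hB.mul hkc (hD.regularOn v c h1)) (hB.mul (reg a ha c hc) (hE.regularOn v c h1)))
    simpa [sq] using this
  · obtain ⟨h1, h2, h3, h4⟩ := H _ h0
    obtain ⟨c, hc, hc'⟩ := hD.hasDerivAt γ w u hγ h1 hw h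
    obtain ⟨d, hd, hd'⟩ := hE.hasDerivAt γ w u hγ h1 hw h
    have ev := (hγ.map_regular hz).eventually_mem W hW h0
    have ev' := (hγ.prodMk h.isSmoothCurve).eventually_mem W hW (by simpa [hw] using h0)
    refine ⟨_, (hc.fun_div hd h3).congr_of_eventuallyEq ?_,
      ((hc'.fun_div hd' (by simpa [hw] using h3)).congr_of_eventuallyEq ?_).congr_deriv ?_⟩
    · filter_upwards [ev] with t ht using (H _ ht).2.2.2
    · filter_upwards [ev'] with t ht using (H _ ht).2.2.2
    · simp [hw]
      ring

theorem isSmoothCurve_fibre (b : B) (v : F) :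
    IsSmoothCurve (totalSpace SB F) fun t : ℝ => (b, (t : ℂ) • v) :=
  (isSmoothCurve_const b).prodMk (hasWeakDeriv_smul v).isSmoothCurve

/-- The linear maps `L b` are the derivatives at `0` of the maps `v ↦ β (b, v)`, compatibly with
the chain rule for curves through the zero section, and they have regular coefficients. -/
structure IsLinearization (SB : FunctionSpace B) (β : B × F → F) (L : B → F →ₗ[ℂ] F) : Prop where
  regularAt : ∀ (l : Module.Dual ℂ F) (v : F) (b : B), SB.RegularAt (fun b => l (L b v)) b
  hasWeakDeriv : ∀ (γ : ℝ → B) (w : ℝ → F) (u : F), IsSmoothCurve SB γ → w 0 = 0 →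
    HasWeakDeriv w u → HasWeakDeriv (fun t => β (γ t, w t)) (L (γ 0) u)

theorem IsNormalDerivative.hasDerivAt_of_zero {φ : B × F → ℂ} {U : Set B}
    {D : B → Module.Dual ℂ F} (hD : IsNormalDerivative SB φ U D) (h0 : ∀ b, φ (b, 0) = 0)
    {γ : ℝ → B} {w : ℝ → F} {u : F} (hγ : IsSmoothCurve SB γ) (hU : γ 0 ∈ U) (hw : w 0 = 0)
    (h : HasWeakDeriv w u) : HasDerivAt (fun t => φ (γ t, w t)) (D (γ 0) u) 0 := by
  obtain ⟨c, hc, hc'⟩ := hD.hasDerivAt γ w u hγ hU hw h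
  simp only [h0] at hc
  rwa [hc.unique (hasDerivAt_const _ _), zero_add] at hc'

/-- Rays in a fibre compute `D b v` from `φ` alone, so local choices of `D` agree on overlaps. -/
theorem IsNormalDerivative.hasDerivAt_fibre {φ : B × F → ℂ} {U : Set B}
    {D : B → Module.Dual ℂ F} (hD : IsNormalDerivative SB φ U D) (h0 : ∀ b, φ (b, 0) = 0)
    {b : B} (hb : b ∈ U) (v : F) :
    HasDerivAt (fun t : ℝ => φ (b, (t : ℂ) • v)) (D b v) 0 :=
  hD.hasDerivAt_of_zero h0 (isSmoothCurve_const b) hb (by simp) (hasWeakDeriv_smul v)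

theorem exists_isLinearization [FiniteDimensional ℂ F] (hB : SB.IsLocallyRinged) {β : B × F → F}
    (hβ : IsRegularMap (totalSpace SB F) (vectorSpace F) β) (h0 : ∀ b, β (b, 0) = 0) :
    ∃ L, IsLinearization SB β L := by
  let e := Module.finBasis ℂ F
  have key := fun i b => exists_isNormalDerivative hB
    (hβ.regularAt_comp (b, 0) _ (vectorSpace_regularAt_dual (e.coord i) _))
  choose U hU hbU D hD using key
  have z : ∀ i b, (e.coord i ∘ β) (b, 0) = 0 := fun i b => by
    simp [Function.comp_apply, h0]
  refine ⟨fun b => ∑ i, (D i b b).smulRight (e i), fun l v b => ?_, fun γ w u hγ hw h l => ?_⟩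
  · have : (fun b => l ((∑ i, (D i b b).smulRight (e i)) v)) =
        fun b => ∑ i, D i b b v * l (e i) := by
      funext b
      simp [LinearMap.sum_apply]
    rw [this]
    refine hB.sum _ fun i => hB.mul ?_ (hB.const _ b)
    -- `D i b` was chosen separately for each `b`. By uniqueness of derivatives along rays, the
    -- diagonal `D i c c` equals `D i b c` for `c` near `b`, and the latter is regular in `c`.
    exact SB.regularAt_congr _ _ (U i b) b (hU i b) (hbU i b)
      (fun c hc => ((hD i b).hasDerivAt_fibre (z i) hc v).unique
        ((hD i c).hasDerivAt_fibre (z i) (hbU i c) v)) ((hD i b).regularOn v b (hbU i b))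
  · have hs := HasDerivAt.fun_sum (u := Finset.univ) fun i _ =>
      ((hD i (γ 0)).hasDerivAt_of_zero (z i) hγ (hbU i _) hw h).mul_const (l (e i))
    refine (hs.congr_of_eventuallyEq (Filter.Eventually.of_forall fun t => ?_)).congr_deriv ?_
    · change l (β (γ t, w t)) = _
      conv_lhs => rw [← e.sum_repr (β (γ t, w t))]
      simp only [map_sum, map_smul, smul_eq_mul]
      rfl
    · simp [LinearMap.sum_apply]

/-- The conjugate of `l ∘ Prod.snd ∘ μ` is regular and so has a normal derivative `D`. Real
linearity of `μ` on rays identifies `D (γ 0) u` with the conjugate of `l (μ (γ 0, u)).2`;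
conjugating back gives the claim. -/
theorem hasWeakDeriv_antiregular {G : Type*} [Group G] [MulAction G B] [DistribMulAction G F]
    {σ : G →* G} {μB : B → B}
    {μ : B × F → B × F} (hB : SB.IsLocallyRinged) (hμ : IsBundleRealForm σ SB μB μ)
    {γ : ℝ → B} {w : ℝ → F} {u : F} (hγ : IsSmoothCurve SB γ) (hw : w 0 = 0)
    (h : HasWeakDeriv w u) :
    HasWeakDeriv (fun t => (μ (γ t, w t)).2) (μ (γ 0, u)).2 := fun l => by
  have h0 : ∀ b, (μ (b, 0)).2 = 0 := fun b => (hμ.fibre_linear b).map_zero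
  have reg := hμ.isRealForm.antiregular.regularAt_comp (γ 0, 0) _
    ((isRegularMap_snd hB vectorSpace_isLocallyRinged).regularAt_comp _ _
      (vectorSpace_regularAt_dual l _))
  obtain ⟨U, hU, hbU, D, hD⟩ := exists_isNormalDerivative hB reg
  have z : ∀ b, (starRingEnd ℂ) (((fun y => l y) ∘ Prod.snd) (μ (b, 0))) = 0 := fun b => by
    simp [h0]
  have h1 := hD.hasDerivAt_of_zero z hγ hbU hw h
  have h2 := hD.hasDerivAt_fibre z hbU u
  have h3 := (hasWeakDeriv_smul (μ (γ 0, u)).2 l).star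
  have h4 : D (γ 0) u = star (l (μ (γ 0, u)).2) := by
    refine h2.unique (h3.congr_of_eventuallyEq (Filter.Eventually.of_forall fun t => ?_))
    have := (hμ.fibre_linear (γ 0)).map_smul t u
    simp only [Function.comp_apply, Complex.coe_smul, this]
    rfl
  have h5 := h1.star
  rw [h4, star_star] at h5
  simpa using h5

end NormalDerivative

/-! ### Linearising equivariant automorphisms and comparing real forms. -/

section Bundles

variable {G : Type*} [Group G] {B : Type*} [MulAction G B]
  {F : Type*} [AddCommGroup F] [Module ℂ F] [DistribMulAction G F]
  {SB : FunctionSpace B}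

theorem IsGAut.symm {Y : Type*} [MulAction G Y] {S : FunctionSpace Y} {ψ : Y ≃ Y}
    (h : IsGAut G S ψ) : IsGAut G S ψ.symm where
  regular := h.regular_symm
  regular_symm := h.regular
  equivariant g y := by
    rw [Equiv.symm_apply_eq, h.equivariant, Equiv.apply_symm_apply]

theorem IsGAut.trans {Y : Type*} [MulAction G Y] {S : FunctionSpace Y} {ψ χ : Y ≃ Y}
    (h : IsGAut G S ψ) (h' : IsGAut G S χ) : IsGAut G S (ψ.trans χ) where
  regular := h'.regular.comp h.regular
  regular_symm := h.regular_symm.comp h'.regular_symm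
  equivariant g y := by simp [h.equivariant, h'.equivariant]

theorem isRegularMap_fst_totalSpace (hB : SB.IsLocallyRinged) :
    IsRegularMap (totalSpace SB F) SB Prod.fst :=
  isRegularMap_fst hB vectorSpace_isLocallyRinged

theorem isRegularMap_snd_totalSpace (hB : SB.IsLocallyRinged) :
    IsRegularMap (totalSpace SB F) (vectorSpace F) Prod.snd :=
  isRegularMap_snd hB vectorSpace_isLocallyRinged

theorem totalSpace_isLocallyRinged (hB : SB.IsLocallyRinged) :
    (totalSpace SB F).IsLocallyRinged :=
  isLocallyRinged_prod hB vectorSpace_isLocallyRinged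

theorem IsGAut.prodCongr_refl (hB : SB.IsLocallyRinged) {f : B ≃ B} (hf : IsGAut G SB f) :
    IsGAut G (totalSpace SB F) (f.prodCongr (Equiv.refl F)) where
  regular := (hf.regular.comp (isRegularMap_fst_totalSpace hB)).prodMk
    (totalSpace_isLocallyRinged hB) (isRegularMap_snd_totalSpace hB)
  regular_symm := (hf.regular_symm.comp (isRegularMap_fst_totalSpace hB)).prodMk
    (totalSpace_isLocallyRinged hB) (isRegularMap_snd_totalSpace hB)
  equivariant g e := Prod.ext (hf.equivariant g e.1) rfl

theorem isRegularMap_fibrewise [FiniteDimensional ℂ F] (hB : SB.IsLocallyRinged)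
    {M : B → F →ₗ[ℂ] F}
    (hM : ∀ (l : Module.Dual ℂ F) (v : F) (b : B), SB.RegularAt (fun b => l (M b v)) b) :
    IsRegularMap (totalSpace SB F) (totalSpace SB F) fun e => (e.1, M e.1 e.2) := by
  have hE := totalSpace_isLocallyRinged (F := F) hB
  refine (isRegularMap_fst_totalSpace hB).prodMk hE (isRegularMap_vectorSpace hE fun l x => ?_)
  let e := Module.finBasis ℂ F
  have : (fun y : B × F => l (M y.1 y.2)) = fun y => ∑ i, e.coord i y.2 * l (M y.1 (e i)) := by
    funext y
    conv_lhs => rw [← e.sum_repr y.2]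
    simp only [map_sum, map_smul, smul_eq_mul]
    rfl
  rw [this]
  exact hE.sum _ fun i => hE.mul
    ((isRegularMap_snd_totalSpace hB).regularAt_comp x _ (vectorSpace_regularAt_dual (e.coord i) _))
    ((isRegularMap_fst_totalSpace hB).regularAt_comp x _ (hM l (e i) _))

theorem mem_fixedPoints_of_equivariant {Y : Type*} [MulAction G Y] {ψ : Y → Y}
    (hψ : ∀ (g : G) (y : Y), ψ (g • y) = g • ψ y) {H : Subgroup G} {y : Y}
    (hy : y ∈ MulAction.fixedPoints H Y) : ψ y ∈ MulAction.fixedPoints H Y := fun h => by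
  have := hψ h y
  rw [show (h : G) • y = y from hy h] at this
  exact this.symm

/-- This is where the assumption on `H` enters: equivariant maps preserve `H`-fixed points. -/
theorem IsGAut.snd_zeroSection {ψ : B × F ≃ B × F} (hψ : IsGAut G (totalSpace SB F) ψ)
    {H : Subgroup G} (hH : MulAction.fixedPoints H (B × F) = {e : B × F | e.2 = 0}) (b : B) :
    (ψ (b, 0)).2 = 0 := by
  have : (b, (0 : F)) ∈ MulAction.fixedPoints H (B × F) := by rw [hH]; rfl
  have h := mem_fixedPoints_of_equivariant hψ.equivariant this
  rwa [hH] at h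

/-- The automorphism of the base induced by an automorphism of the total space that preserves the
zero section. -/
def baseEquiv (ψ : B × F ≃ B × F) (h : ∀ b, (ψ (b, 0)).2 = 0) (h' : ∀ b, (ψ.symm (b, 0)).2 = 0) :
    B ≃ B where
  toFun b := (ψ (b, 0)).1
  invFun b := (ψ.symm (b, 0)).1
  left_inv b := by
    beta_reduce
    rw [show ((ψ (b, 0)).1, (0 : F)) = ψ (b, 0) from Prod.ext rfl (h b).symm, ψ.symm_apply_apply]
  right_inv b := by
    beta_reduce
    rw [show ((ψ.symm (b, 0)).1, (0 : F)) = ψ.symm (b, 0) from Prod.ext rfl (h' b).symm,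
      ψ.apply_symm_apply]

theorem IsGAut.baseEquiv (hB : SB.IsLocallyRinged) {ψ : B × F ≃ B × F}
    (hψ : IsGAut G (totalSpace SB F) ψ) (h : ∀ b, (ψ (b, 0)).2 = 0)
    (h' : ∀ b, (ψ.symm (b, 0)).2 = 0) : IsGAut G SB (baseEquiv ψ h h') where
  regular := ((isRegularMap_fst_totalSpace hB).comp hψ.regular).comp (isRegularMap_zeroSection hB)
  regular_symm :=
    ((isRegularMap_fst_totalSpace hB).comp hψ.regular_symm).comp (isRegularMap_zeroSection hB)
  equivariant g b := by
    have := hψ.equivariant g (b, 0)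
    rw [Prod.smul_mk, smul_zero] at this
    exact congrArg Prod.fst this

/-- The derivative of a composite along the zero section is the composite of the derivatives. -/
theorem IsLinearization.comp_apply (hB : SB.IsLocallyRinged) {ψ χ : B × F → B × F}
    {L M : B → F →ₗ[ℂ] F}
    (hψ : IsRegularMap (totalSpace SB F) (totalSpace SB F) ψ)
    (hL : IsLinearization SB (fun e => (ψ e).2) L) (hM : IsLinearization SB (fun e => (χ e).2) M)
    (h0 : ∀ b, (ψ (b, 0)).2 = 0) (b : B) (v : F) :
    HasWeakDeriv (fun t : ℝ => (χ (ψ (b, (t : ℂ) • v))).2) (M (ψ (b, 0)).1 (L b v)) := by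
  have h1 := hL.hasWeakDeriv (fun _ => b) _ v (isSmoothCurve_const b) (by simp)
    (hasWeakDeriv_smul v)
  have h2 := ((isSmoothCurve_fibre b v).map_regular hψ).map_regular
    (isRegularMap_fst_totalSpace hB)
  have h3 := hM.hasWeakDeriv _ _ _ h2 (by simp [h0]) h1
  simpa using h3

theorem RealFormEquiv.exists_bundleRealFormEquiv [FiniteDimensional ℂ F]
    {σ : G →* G} {μB : B → B} {μ₁ μ₂ : B × F → B × F} (hB : SB.IsLocallyRinged)
    (hF : ∀ (g : G) (c : ℂ) (v : F), g • (c • v) = c • (g • v))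
    {H : Subgroup G} (hH : MulAction.fixedPoints H (B × F) = {e : B × F | e.2 = 0})
    (hμ₁ : IsBundleRealForm σ SB μB μ₁) (hμ₂ : IsBundleRealForm σ SB μB μ₂)
    (h : RealFormEquiv G (totalSpace SB F) μ₁ μ₂) :
    ∃ f : B ≃ B, IsGAut G SB f ∧ f ∘ μB ∘ f.symm = μB ∧
      BundleRealFormEquiv G SB μ₁ (pullbackForm f μ₂) := by
  obtain ⟨ψ, hψ, hμ⟩ := h
  have z := hψ.snd_zeroSection hH
  have z' := hψ.symm.snd_zeroSection hH
  have hf := hψ.baseEquiv hB z z'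
  set f := baseEquiv ψ z z'
  have hμψ : ∀ e, μ₂ (ψ e) = ψ (μ₁ e) := fun e => by simp [hμ]
  have hψ0 : ∀ b, ψ (b, 0) = (f b, 0) := fun b => Prod.ext rfl (z b)
  have hψ0' : ∀ b, ψ.symm (b, 0) = (f.symm b, 0) := fun b => Prod.ext rfl (z' b)
  have hμ0 : ∀ {μ}, IsBundleRealForm σ SB μB μ → ∀ b, μ (b, (0 : F)) = (μB b, 0) :=
    fun h b => Prod.ext (h.over_base _) (h.fibre_linear b).map_zero
  have hfμ : ∀ b, μB (f b) = f (μB b) := fun b => by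
    have := hμψ (b, 0)
    rw [hψ0, hμ0 hμ₁, hμ0 hμ₂, hψ0] at this
    exact congrArg Prod.fst this
  have hsnd := isRegularMap_snd_totalSpace (F := F) hB
  obtain ⟨L, hL⟩ := exists_isLinearization hB (hsnd.comp hψ.regular) z
  obtain ⟨M, hM⟩ := exists_isLinearization hB (hsnd.comp hψ.regular_symm) z'
  -- Differentiate `ψ⁻¹ ∘ ψ = id` along the ray `t • v`; the base component of `ψ (b, t • v)` may
  -- move, but it does not affect the fibre derivative.
  have hML : ∀ b v, M (f b) (L b v) = v := fun b v => by
    have := IsLinearization.comp_apply hB hψ.regular hL hM z b v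
    simp only [Equiv.symm_apply_apply] at this
    exact this.unique (hasWeakDeriv_smul v)
  have hLM : ∀ b v, L b (M (f b) v) = v := fun b v => by
    have := IsLinearization.comp_apply hB hψ.regular_symm hM hL z' (f b) v
    simp only [Equiv.apply_symm_apply, hψ0', Equiv.symm_apply_apply] at this
    exact this.unique (hasWeakDeriv_smul v)
  have hLd : ∀ b v, HasWeakDeriv (fun t : ℝ => (ψ (b, (t : ℂ) • v)).2) (L b v) := fun b v =>
    hL.hasWeakDeriv (fun _ => b) _ v (isSmoothCurve_const b) (by simp) (hasWeakDeriv_smul v)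
  -- Both sides are derivatives of the `F`-component of `ψ (g • (b, t • v)) = g • ψ (b, t • v)`.
  have hLg : ∀ (g : G) b v, L (g • b) (g • v) = g • L b v := fun g b v => by
    let A : F →ₗ[ℂ] F := ⟨⟨fun v => g • v, smul_add g⟩, hF g⟩
    refine (hLd (g • b) (g • v)).unique ?_
    change HasWeakDeriv _ (A (L b v))
    convert (hLd b v).map A using 2 with t
    rw [← hF, ← Prod.smul_mk, hψ.equivariant]
    rfl
  -- Differentiate `μ₂ (ψ (b, t • v)) = ψ (μ₁ (b, t • v))` in two ways. On the right, `μ₁` sends the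
  -- ray to a ray because `t` is real.
  have hLμ : ∀ b v, (μ₂ (f b, L b v)).2 = L (μB b) (μ₁ (b, v)).2 := fun b v => by
    have h1 := hasWeakDeriv_antiregular hB hμ₂
      (((isSmoothCurve_fibre b v).map_regular hψ.regular).map_regular
        (isRegularMap_fst_totalSpace hB)) (by simp [z]) (hLd b v)
    have h2 := hLd (μB b) (μ₁ (b, v)).2
    simp only [Complex.ofReal_zero, zero_smul, hψ0] at h1
    refine h1.unique ?_
    convert h2 using 2 with t
    rw [Prod.mk.eta, hμψ]
    congr 2
    refine Prod.ext (hμ₁.over_base _) ?_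
    simpa only [Complex.coe_smul] using (hμ₁.fibre_linear b).map_smul t v
  let Λ : B × F ≃ B × F :=
    ⟨fun e => (e.1, L e.1 e.2), fun e => (e.1, M (f e.1) e.2),
      fun e => by simp [hML], fun e => by simp [hLM]⟩
  -- The linearisation of `ψ` is `(f × id) ∘ Λ`, and it conjugates `μ₁` to `μ₂`. Hence `Λ`
  -- conjugates `μ₁` to `(f × id)⁻¹ ∘ μ₂ ∘ (f × id)`, which is the pullback by `f.symm` rather than
  -- by `f`.
  refine ⟨f.symm, hf.symm, ?_, Λ, ⟨⟨isRegularMap_fibrewise hB hL.regularAt, ?_, ?_⟩, fun _ => rfl,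
    fun b => ⟨(L b).map_add, (L b).map_smul⟩⟩, ?_⟩
  · funext b
    simp [hfμ]
  · exact isRegularMap_fibrewise hB (M := fun b => M (f b)) fun l v b =>
      hf.regular.regularAt_comp b _ (hM.regularAt l v _)
  · exact fun g e => Prod.ext rfl (hLg g e.1 e.2)
  · have key : pullbackForm f.symm μ₂ ∘ Λ = Λ ∘ μ₁ := by
      funext e
      refine Prod.ext ?_ ?_
      · change f.symm (μ₂ (f e.1, L e.1 e.2)).1 = (μ₁ e).1
        rw [hμ₂.over_base, hμ₁.over_base, hfμ, Equiv.symm_apply_apply]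
      · change (μ₂ (f e.1, L e.1 e.2)).2 = L (μ₁ e).1 (μ₁ e).2
        rw [hLμ, hμ₁.over_base]
    funext e
    simpa using congrFun key (Λ.symm e)

theorem RealFormEquiv.of_bundleRealFormEquiv {μ₁ μ₂ : B × F → B × F} (hB : SB.IsLocallyRinged)
    {f : B ≃ B} (hf : IsGAut G SB f) (h : BundleRealFormEquiv G SB μ₁ (pullbackForm f μ₂)) :
    RealFormEquiv G (totalSpace SB F) μ₁ μ₂ := by
  obtain ⟨ψ, hψ, h⟩ := h
  refine ⟨ψ.trans (f.prodCongr (Equiv.refl F)).symm,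
    hψ.isGAut.trans (hf.prodCongr_refl hB).symm, ?_⟩
  funext e
  have := congrFun h (f.prodCongr (Equiv.refl F) e)
  simp only [pullbackForm, Function.comp_apply, Equiv.symm_apply_apply] at this
  simp only [Function.comp_apply, Equiv.trans_apply, Equiv.symm_trans_apply, Equiv.symm_symm,
    ← this, Equiv.symm_apply_apply]

end Bundles

end EquivariantRealForms

theorem proposition4p2
    {G : Type*} [Group G] (SG : EquivariantRealForms.FunctionSpace G)
    (hG : EquivariantRealForms.IsAlgebraicGroup SG)
    (σ : G →* G) (hσ : EquivariantRealForms.IsGroupRealForm SG σ)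
    {B : Type*} [MulAction G B] (SB : EquivariantRealForms.FunctionSpace B)
    (hB : EquivariantRealForms.IsGVariety SG SB)
    (μB : B → B) (hμB : EquivariantRealForms.IsRealForm σ SB μB)
    {F : Type*} [AddCommGroup F] [Module ℂ F] [FiniteDimensional ℂ F] [DistribMulAction G F]
    (hF : EquivariantRealForms.IsGModule SG F)
    (H : Subgroup G) (hH : MulAction.fixedPoints H (B × F) = {e : B × F | e.2 = 0})
    (μ₁ μ₂ : B × F → B × F)
    (hμ₁ : EquivariantRealForms.IsBundleRealForm σ SB μB μ₁)
    (hμ₂ : EquivariantRealForms.IsBundleRealForm σ SB μB μ₂) :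
    EquivariantRealForms.RealFormEquiv G
        (EquivariantRealForms.totalSpace SB F) μ₁ μ₂ ↔
      ∃ f : B ≃ B, EquivariantRealForms.IsGAut G SB f ∧ f ∘ μB ∘ f.symm = μB ∧
        EquivariantRealForms.BundleRealFormEquiv G SB μ₁
          (EquivariantRealForms.pullbackForm f μ₂) := by
  have hSB := hB.isVariety.isLocallyRinged
  exact ⟨fun h => h.exists_bundleRealFormEquiv hSB hF.smul_comm hH hμ₁ hμ₂,
    fun ⟨_, hf, _, h⟩ => .of_bundleRealFormEquiv hSB hf h⟩
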